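/- All graphs are finite, simple, undirected and connected; $\partial$ denotes path-length distance. For a graph $\Gamma$ with vertex set $X$, adjacency matrix $A$ and a vertex $x$, let $\varepsilon=\max_{y\in X}\partial(x,y)$, let $V=\mathbb{C}^X$, and for $0\le i\le\varepsilon$ let $E_i^*\in \mathrm{Mat}_X(\mathbb{C})$ be the diagonal matrix whose $(y,y)$-entry is $1$ if $\partial(x,y)=i$ and $0$ otherwise. Put $L=\sum_{i=1}^{\varepsilon}E^*_{i-1}AE^*_i$ and $R=\sum_{i=0}^{\varepsilon-1}E^*_{i+1}AE^*_i$. A *parameter matrix* is a tridiagonal matrix $U=(e_{ij})_{1\le i,j\le\varepsilon}$ over $\mathbb{C}$ such that (i) $e_{ii}=1$ for all $i$; (ii) either $e_{i,i-1}\ne 0$ for all $2\le i\le\varepsilon$, or $e_{i-1,i}\neq 0$ for all $2\le i\le\varepsilon$; (iii) the principal submatrix $(e_{ij})_{s\le i,j\le t}$ is nonsingular for all $1\le s\le t\le\varepsilon$. Write $e_i^-=e_{i,i-1}$ $(2\le i\le\varepsilon)$, $e_i^+=e_{i,i+1}$ $(1\le i\le\varepsilon-1)$ and $e_1^-=e_\varepsilon^+=0$.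 A *uniform structure* of a bipartite graph $\Gamma$ with respect to $x$ is a pair $(U,f)$ consisting of a parameter matrix $U$ and a vector $f=(f_i)_{i=1}^{\varepsilon}\in\mathbb{C}^\varepsilon$ such that, for $1\le i\le\varepsilon$, $$e_i^-RL^2+LRL+e_i^+L^2R=f_iL\quad\text{holds on } E_i^*V.$$ A non-bipartite graph $\Gamma$ *supports a uniform structure with respect to $x$* if the (bipartite, connected) graph $\Gamma_f=\Gamma_f(x)$, obtained from $\Gamma$ by deleting all edges $yz$ with $\partial(x,y)=\partial(x,z)$, admits a uniform structure with respect to $x$. **Corollary 9.3.** Let $\Gamma$ be (isomorphic to) one of the following graphs: * the Johnson graph $J(2D,D)$ with $D\ge 3$ (the $D$-subsets of a $2D$-set, adjacent when they meet in $D-1$ elements); * the Gosset graph (56 vertices, two copies of the set of 2-subsets of $\{1,\dots,8\}$; in the same copy two 2-subsets are adjacent when they meet in one element, in different copies they are adjacent when they are disjoint); * the halved cube $\tfrac12H(n,2)$ with $n$ even, $n\ge 6$ (the binary words of length $n$ and even weight, adjacent at Hamming distance $2$). Then for every vertex $x$ of $\Gamma$, $\Gamma$ does not support a uniform structure with respect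 to $x$. -/

import Mathlib

/-! ## Matrices attached to a vertex of a finite graph -/

section Terwilliger

variable {X : Type*} [Fintype X] [DecidableEq X]

/-- The eccentricity `ε(x) = max {∂(x, y) | y}`, where `∂` is the path-length distance
(the graphs considered are connected). -/
noncomputable def graphEcc (Γ : SimpleGraph X) (x : X) : ℕ :=
  Finset.univ.sup (fun y => Γ.dist x y)

/-- The `i`-th dual idempotent `E*_i` of `Γ` with respect to `x`. -/
noncomputable def dualIdempotent (Γ : SimpleGraph X) (x : X) (i : ℕ) : Matrix X X ℂ :=
  Matrix.diagonal (fun y => if Γ.dist x y = i then 1 else 0)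

open Classical in
/-- The adjacency matrix of `Γ` over `ℂ`. -/
noncomputable def complexAdjMatrix (Γ : SimpleGraph X) : Matrix X X ℂ :=
  Γ.adjMatrix ℂ

/-- The lowering matrix `L = ∑_{i=1}^{ε} E*_{i-1} A E*_i` of `Γ` with respect to `x`. -/
noncomputable def loweringMatrix (Γ : SimpleGraph X) (x : X) : Matrix X X ℂ :=
  ∑ i ∈ Finset.range (graphEcc Γ x),
    dualIdempotent Γ x i * complexAdjMatrix Γ * dualIdempotent Γ x (i + 1)

/-- The raising matrix `R = ∑_{i=0}^{ε-1} E*_{i+1} A E*_i` of `Γ` with respect to `x`. -/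
noncomputable def raisingMatrix (Γ : SimpleGraph X) (x : X) : Matrix X X ℂ :=
  ∑ i ∈ Finset.range (graphEcc Γ x),
    dualIdempotent Γ x (i + 1) * complexAdjMatrix Γ * dualIdempotent Γ x i

/-- The `i`-th subconstituent `E*_i V` of `Γ` with respect to `x`, a subspace of the standard
module `V = ℂ^X`. -/
noncomputable def subconstituent (Γ : SimpleGraph X) (x : X) (i : ℕ) : Submodule ℂ (X → ℂ) :=
  LinearMap.range (Matrix.mulVecLin (dualIdempotent Γ x i))

end Terwilliger

/-! ## Uniform structures -/

/-- `U = (e_{ij})_{1 ≤ i, j ≤ N}` is a parameter matrix.  The row and column with (one-based)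
number `i` have index `i - 1` in `Fin N`. -/
structure IsParameterMatrix {N : ℕ} (U : Matrix (Fin N) (Fin N) ℂ) : Prop where
  tridiagonal : ∀ i j : Fin N, ((i : ℕ) + 1 < j ∨ (j : ℕ) + 1 < i) → U i j = 0
  diag_eq_one : ∀ i : Fin N, U i i = 1
  offDiag_ne_zero :
    (∀ i j : Fin N, (j : ℕ) + 1 = i → U i j ≠ 0) ∨
    (∀ i j : Fin N, (i : ℕ) + 1 = j → U i j ≠ 0)
  /-- Every principal submatrix on a nonempty interval of indices `s ≤ i, j ≤ t` is nonsingular. -/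
  principal_nonsingular : ∀ s t : Fin N, s ≤ t →
    (U.submatrix (fun i : {i : Fin N // s ≤ i ∧ i ≤ t} => i.1)
      (fun j : {j : Fin N // s ≤ j ∧ j ≤ t} => j.1)).det ≠ 0

/-- `e⁻` of a row: the entry just left of the diagonal, and `0` for the first row. -/
noncomputable def eMinus {N : ℕ} (U : Matrix (Fin N) (Fin N) ℂ) (k : Fin N) : ℂ :=
  if 0 < (k : ℕ) then U k ⟨(k : ℕ) - 1, lt_of_le_of_lt (Nat.sub_le _ _) k.isLt⟩ else 0

/-- `e⁺` of a row: the entry just right of the diagonal, and `0` for the last row. -/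
noncomputable def ePlus {N : ℕ} (U : Matrix (Fin N) (Fin N) ℂ) (k : Fin N) : ℂ :=
  if h : (k : ℕ) + 1 < N then U k ⟨(k : ℕ) + 1, h⟩ else 0

section Uniform

variable {X : Type*} [Fintype X] [DecidableEq X]

/-- `(U, f)` is a uniform structure of the (connected, bipartite) graph `Γ` with respect to `x`:
`U` is a parameter matrix and `e⁻_i R L² + L R L + e⁺_i L² R = f_i L` holds on `E*_i V` for
`1 ≤ i ≤ ε(x)`.  The number `i` is `k + 1` for `k : Fin (ε(x))`. -/
structure IsUniformStructure (Γ : SimpleGraph X) (x : X)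
    (U : Matrix (Fin (graphEcc Γ x)) (Fin (graphEcc Γ x)) ℂ)
    (f : Fin (graphEcc Γ x) → ℂ) : Prop where
  isParameterMatrix : IsParameterMatrix U
  uniform : ∀ k : Fin (graphEcc Γ x), ∀ v ∈ subconstituent Γ x ((k : ℕ) + 1),
    Matrix.mulVec
      (eMinus U k • (raisingMatrix Γ x * loweringMatrix Γ x ^ 2)
        + loweringMatrix Γ x * raisingMatrix Γ x * loweringMatrix Γ x
        + ePlus U k • (loweringMatrix Γ x ^ 2 * raisingMatrix Γ x)) v
      = Matrix.mulVec (f k • loweringMatrix Γ x) v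

/-- `Γ` admits a uniform structure with respect to `x`. -/
def AdmitsUniformStructure (Γ : SimpleGraph X) (x : X) : Prop :=
  ∃ (U : Matrix (Fin (graphEcc Γ x)) (Fin (graphEcc Γ x)) ℂ) (f : Fin (graphEcc Γ x) → ℂ),
    IsUniformStructure Γ x U f

end Uniform

/-- The graph `Γ_f(x)`: delete from `Γ` all edges `yz` with `∂(x, y) = ∂(x, z)`. -/
def flatDeleted {X : Type*} (Γ : SimpleGraph X) (x : X) : SimpleGraph X where
  Adj y z := Γ.Adj y z ∧ Γ.dist x y ≠ Γ.dist x z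
  symm := ⟨fun _ _ h => ⟨h.1.symm, h.2.symm⟩⟩
  loopless := ⟨fun _ h => h.2 rfl⟩

/-- `Γ` supports a uniform structure with respect to `x`: the bipartite graph `Γ_f(x)` admits a
uniform structure with respect to `x`. -/
def SupportsUniformStructure {X : Type*} [Fintype X] [DecidableEq X]
    (Γ : SimpleGraph X) (x : X) : Prop :=
  AdmitsUniformStructure (flatDeleted Γ x) x

/-! ## The three families of graphs -/

/-- The Johnson graph `J(n, d)`: the `d`-subsets of an `n`-set, two of them being adjacent when
they meet in exactly `d - 1` elements. -/
def johnsonGraph (n d : ℕ) : SimpleGraph {s : Finset (Fin n) // s.card = d} where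
  Adj s t := (s.1 ∩ t.1).card + 1 = d
  symm := ⟨fun s t h => by rw [Finset.inter_comm]; exact h⟩
  loopless := ⟨fun s h => by rw [Finset.inter_self, s.2] at h; omega⟩

/-- The Gosset graph on 56 vertices: two copies of the set of edges (2-subsets) of the complete
graph on 8 points; two vertices in the same copy are adjacent when the edges share exactly one
point, two vertices in different copies are adjacent when the edges are disjoint. -/
def gossetGraph : SimpleGraph (Bool × {s : Finset (Fin 8) // s.card = 2}) where
  Adj u v := (u.1 = v.1 ∧ (u.2.1 ∩ v.2.1).card = 1) ∨ (u.1 ≠ v.1 ∧ Disjoint u.2.1 v.2.1)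
  symm := ⟨fun u v h => by
    rcases h with ⟨h, h'⟩ | ⟨h, h'⟩
    · exact Or.inl ⟨h.symm, by rw [Finset.inter_comm]; exact h'⟩
    · exact Or.inr ⟨h.symm, h'.symm⟩⟩
  loopless := ⟨fun u h => by
    rcases h with ⟨_, h⟩ | ⟨h, _⟩
    · rw [Finset.inter_self, u.2.2] at h; omega
    · exact h rfl⟩

/-- The halved cube `½H(n, 2)`: the binary words of length `n` and even weight (one bipartite half
of the hypercube `H(n, 2)`), two of them being adjacent at Hamming distance `2`. -/
def halvedCube (n : ℕ) : SimpleGraph {v : Fin n → ZMod 2 // Even (hammingNorm v)} where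
  Adj u v := hammingDist u.1 v.1 = 2
  symm := ⟨fun u v h => by rw [hammingDist_comm]; exact h⟩
  loopless := ⟨fun u h => by rw [hammingDist_self] at h; omega⟩

/-! Let `g` be a function whose restrictions `g_i` to the distance layers satisfy `R g_i = β (i+1)
g_(i+1)` and `L g_(i+1) = γ i g_i`, with `β 1 = 0` and `γ (D-1) = 0`. The `g_i` with `1 ≤ i ≤ D-1`
behave like a basis of a thin module with endpoint 1 for the algebra generated by `L` and `R`.
Applying the uniform relation to `g_(i+2)` and cancelling the common factor `γ (i+1)` leaves an
equation that is linear in the products `c_i = γ i * β (i+1)`, with coefficients from one row of `U`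
and right-hand side from `f`.

Given two such functions, the difference `d` of their products satisfies the homogeneous tridiagonal
system and vanishes at both ends, at `0` and `D-1`. Nonsingularity of the principal submatrix on the
indices in between forces `d = 0`. So a uniform structure allows only one value of `γ 1 * β 2`, and
two functions with different values exclude it (`not_supportsUniformStructure_of_eigenfunctions`).

Each family has such a pair. In the Johnson and halved cube cases both come from eigenfunctions of
the down and up sums on a Boolean lattice: constants, sums of a weight of total zero, and products
of two such sums with disjoint supports. For the Gosset graph two explicit functions are checked by
finite computation. -/

/-! ## Layer functions -/

section Layers

variable {X Y : Type*}

/-- `ℓ` is the distance from `x` in the graph `Γ`, whose eccentricity at `x` is `D`; this is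
phrased locally, in terms of adjacent vertices. -/
structure IsLayerFunction (Γ : SimpleGraph X) (x : X) (ℓ : X → ℕ) (D : ℕ) : Prop where
  eq_of_zero : ∀ y, ℓ y = 0 → y = x
  base : ℓ x = 0
  le_succ : ∀ y z, Γ.Adj y z → ℓ z ≤ ℓ y + 1
  exists_pred : ∀ y, ℓ y ≠ 0 → ∃ z, Γ.Adj z y ∧ ℓ z + 1 = ℓ y
  le_max : ∀ y, ℓ y ≤ D
  exists_max : ∃ y, ℓ y = D

open Classical in
/-- On each layer of `ℓ`, the function `g` is, up to a scalar depending on the layer only, the sum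
of its values over the neighbours in the previous layer, and likewise for the next layer. -/
structure IsLayeredEigenfunction [Fintype X] (Γ : SimpleGraph X) (ℓ : X → ℕ) (D : ℕ) (g : X → ℂ)
    (β γ : ℕ → ℂ) : Prop where
  sum_lower : ∀ y, ∑ z, (if Γ.Adj y z ∧ ℓ z + 1 = ℓ y then g z else 0) = β (ℓ y) * g y
  sum_upper : ∀ y, ∑ z, (if Γ.Adj y z ∧ ℓ z = ℓ y + 1 then g z else 0) = γ (ℓ y) * g y
  beta_one : β 1 = 0
  gamma_last : γ (D - 1) = 0
  gamma_ne_zero : ∀ i, 1 ≤ i → i + 2 ≤ D → γ i ≠ 0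
  exists_ne_zero : ∀ i, 1 ≤ i → i + 2 ≤ D → ∃ y, ℓ y = i ∧ g y ≠ 0

theorem IsLayerFunction.comp_iso {Γ : SimpleGraph X} {Γ' : SimpleGraph Y} {x : X} {ℓ : Y → ℕ}
    {D : ℕ} (e : Γ ≃g Γ') (h : IsLayerFunction Γ' (e x) ℓ D) :
    IsLayerFunction Γ x (ℓ ∘ e) D where
  eq_of_zero y hy := e.injective (h.eq_of_zero _ hy)
  base := h.base
  le_succ y z hyz := h.le_succ _ _ (e.map_adj_iff.2 hyz)
  exists_pred y hy := by
    obtain ⟨z, hz, hz'⟩ := h.exists_pred (e y) hy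
    refine ⟨e.symm z, ?_, by simpa using hz'⟩
    rw [← e.map_adj_iff]
    simpa using hz
  le_max y := h.le_max _
  exists_max := by
    obtain ⟨y, hy⟩ := h.exists_max
    exact ⟨e.symm y, by simpa using hy⟩

theorem IsLayeredEigenfunction.comp_iso [Fintype X] [Fintype Y] {Γ : SimpleGraph X}
    {Γ' : SimpleGraph Y} {ℓ : Y → ℕ} {D : ℕ} {g : Y → ℂ} {β γ : ℕ → ℂ} (e : Γ ≃g Γ')
    (h : IsLayeredEigenfunction Γ' ℓ D g β γ) :
    IsLayeredEigenfunction Γ (ℓ ∘ e) D (g ∘ e) β γ where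
  sum_lower y := by
    classical
    refine Eq.trans ?_ (h.sum_lower (e y))
    refine Fintype.sum_equiv e.toEquiv _ _ fun z => ?_
    simp [e.map_adj_iff]
  sum_upper y := by
    classical
    refine Eq.trans ?_ (h.sum_upper (e y))
    refine Fintype.sum_equiv e.toEquiv _ _ fun z => ?_
    simp [e.map_adj_iff]
  beta_one := h.beta_one
  gamma_last := h.gamma_last
  gamma_ne_zero := h.gamma_ne_zero
  exists_ne_zero i hi hi' := by
    obtain ⟨y, hy, hy'⟩ := h.exists_ne_zero i hi hi'
    exact ⟨e.symm y, by simpa using hy, by simpa using hy'⟩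

theorem IsLayerFunction.exists_walk {Γ : SimpleGraph X} {x : X} {ℓ : X → ℕ} {D : ℕ}
    (h : IsLayerFunction Γ x ℓ D) (n : ℕ) :
    ∀ y, ℓ y = n → ∃ p : Γ.Walk x y, p.length = n := by
  induction n with
  | zero =>
    intro y hy
    obtain rfl := h.eq_of_zero y hy
    exact ⟨.nil, rfl⟩
  | succ n ih =>
    intro y hy
    obtain ⟨z, hz, hz'⟩ := h.exists_pred y (by omega)
    obtain ⟨p, hp⟩ := ih z (by omega)
    exact ⟨p.concat hz, by simp [hp]⟩

theorem IsLayerFunction.le_add_length {Γ : SimpleGraph X} {x : X} {ℓ : X → ℕ} {D : ℕ}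
    (h : IsLayerFunction Γ x ℓ D) {y z : X} (p : Γ.Walk y z) : ℓ z ≤ ℓ y + p.length := by
  induction p with
  | nil => simp
  | cons hadj p ih =>
    have := h.le_succ _ _ hadj
    rw [SimpleGraph.Walk.length_cons]
    omega

/-- Predecessors chain down to `x` and give a walk of length `ℓ y`; since `ℓ` rises by at most one
along an edge, no walk is shorter. -/
theorem IsLayerFunction.dist_eq {Γ : SimpleGraph X} {x : X} {ℓ : X → ℕ} {D : ℕ}
    (h : IsLayerFunction Γ x ℓ D) (y : X) : Γ.dist x y = ℓ y := by
  obtain ⟨p, hp⟩ := h.exists_walk _ y rfl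
  refine le_antisymm (hp ▸ SimpleGraph.dist_le p) ?_
  obtain ⟨q, hq⟩ := p.reachable.exists_walk_length_eq_dist
  have := h.le_add_length q
  rw [h.base] at this
  omega

theorem IsLayerFunction.flatDeleted_adj {Γ : SimpleGraph X} {x : X} {ℓ : X → ℕ} {D : ℕ}
    (h : IsLayerFunction Γ x ℓ D) (y z : X) :
    (flatDeleted Γ x).Adj y z ↔ Γ.Adj y z ∧ ℓ y ≠ ℓ z := by
  simp [flatDeleted, h.dist_eq]

/-- Edges to predecessors join different layers and so are not deleted. Hence distances from `x` are
the same in both graphs. -/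
theorem IsLayerFunction.flatDeleted {Γ : SimpleGraph X} {x : X} {ℓ : X → ℕ} {D : ℕ}
    (h : IsLayerFunction Γ x ℓ D) : IsLayerFunction (flatDeleted Γ x) x ℓ D where
  eq_of_zero := h.eq_of_zero
  base := h.base
  le_succ y z hyz := h.le_succ y z ((h.flatDeleted_adj y z).1 hyz).1
  exists_pred y hy := by
    obtain ⟨z, hz, hz'⟩ := h.exists_pred y hy
    exact ⟨z, (h.flatDeleted_adj z y).2 ⟨hz, by omega⟩, hz'⟩
  le_max := h.le_max
  exists_max := h.exists_max

/-- Both sums only involve edges between consecutive layers, and none of these is deleted. -/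
theorem IsLayeredEigenfunction.flatDeleted [Fintype X] {Γ : SimpleGraph X} {x : X} {ℓ : X → ℕ}
    {D : ℕ} (hℓ : IsLayerFunction Γ x ℓ D) {g : X → ℂ} {β γ : ℕ → ℂ}
    (h : IsLayeredEigenfunction Γ ℓ D g β γ) :
    IsLayeredEigenfunction (flatDeleted Γ x) ℓ D g β γ where
  sum_lower y := by
    classical
    rw [← h.sum_lower]
    refine Finset.sum_congr rfl fun z _ => if_congr ?_ rfl rfl
    rw [hℓ.flatDeleted_adj]
    refine ⟨fun h => ⟨h.1.1, h.2⟩, fun h => ⟨⟨h.1, by omega⟩, h.2⟩⟩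
  sum_upper y := by
    classical
    rw [← h.sum_upper]
    refine Finset.sum_congr rfl fun z _ => if_congr ?_ rfl rfl
    rw [hℓ.flatDeleted_adj]
    refine ⟨fun h => ⟨h.1.1, h.2⟩, fun h => ⟨⟨h.1, by omega⟩, h.2⟩⟩
  beta_one := h.beta_one
  gamma_last := h.gamma_last
  gamma_ne_zero := h.gamma_ne_zero
  exists_ne_zero := h.exists_ne_zero

theorem IsLayerFunction.graphEcc_eq [Fintype X] {G : SimpleGraph X} {x : X} {ℓ : X → ℕ}
    {D : ℕ} (h : IsLayerFunction G x ℓ D) :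
    graphEcc G x = D := by
  obtain ⟨y, hy⟩ := h.exists_max
  refine le_antisymm (Finset.sup_le fun z _ => by rw [h.dist_eq]; exact h.le_max z) ?_
  rw [← hy, ← h.dist_eq]
  exact Finset.le_sup (f := fun y => G.dist x y) (Finset.mem_univ y)

end Layers

/-! ## Raising and lowering matrices on layered eigenfunctions -/

section Matrices

variable {X : Type*} [Fintype X] [DecidableEq X] {G : SimpleGraph X} {x : X} {ℓ : X → ℕ} {D : ℕ}

open Classical in
theorem IsLayerFunction.loweringMatrix_apply (h : IsLayerFunction G x ℓ D) (y z : X) :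
    loweringMatrix G x y z = if G.Adj y z ∧ ℓ z = ℓ y + 1 then 1 else 0 := by
  have hterm : ∀ i, (dualIdempotent G x i * complexAdjMatrix G * dualIdempotent G x (i + 1)) y z
      = if i = ℓ y then (if G.Adj y z ∧ ℓ z = ℓ y + 1 then 1 else 0) else 0 := by
    intro i
    simp only [dualIdempotent, complexAdjMatrix, Matrix.mul_diagonal, Matrix.diagonal_mul,
      SimpleGraph.adjMatrix_apply, h.dist_eq]
    grind
  rw [loweringMatrix, Matrix.sum_apply, Finset.sum_congr rfl fun i _ => hterm i,
    Finset.sum_ite_eq', h.graphEcc_eq]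
  -- The surviving summand `i = ℓ y` lies in the range because `ℓ y + 1 = ℓ z ≤ D`.
  have := h.le_max z
  simp only [Finset.mem_range]
  grind

open Classical in
theorem IsLayerFunction.raisingMatrix_apply (h : IsLayerFunction G x ℓ D) (y z : X) :
    raisingMatrix G x y z = if G.Adj y z ∧ ℓ z + 1 = ℓ y then 1 else 0 := by
  have hterm : ∀ i, (dualIdempotent G x (i + 1) * complexAdjMatrix G * dualIdempotent G x i) y z
      = if i = ℓ z then (if G.Adj y z ∧ ℓ z + 1 = ℓ y then 1 else 0) else 0 := by
    intro i
    simp only [dualIdempotent, complexAdjMatrix, Matrix.mul_diagonal, Matrix.diagonal_mul,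
      SimpleGraph.adjMatrix_apply, h.dist_eq]
    grind
  rw [raisingMatrix, Matrix.sum_apply, Finset.sum_congr rfl fun i _ => hterm i,
    Finset.sum_ite_eq', h.graphEcc_eq]
  have := h.le_max y
  simp only [Finset.mem_range]
  grind

/-- The restriction of a function to the layer `i` of `ℓ`. -/
def layerPart (ℓ : X → ℕ) (g : X → ℂ) (i : ℕ) : X → ℂ :=
  fun y => if ℓ y = i then g y else 0

theorem IsLayerFunction.layerPart_mem (h : IsLayerFunction G x ℓ D) (g : X → ℂ) (i : ℕ) :
    layerPart ℓ g i ∈ subconstituent G x i := by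
  refine ⟨g, ?_⟩
  ext y
  simp [dualIdempotent, Matrix.mulVec_diagonal, layerPart, h.dist_eq]

/-- The `y`-entry of `L` applied to a layer sums over the neighbours of `y` one layer up, so
lowering is governed by `γ`, indexed by the target layer. -/
theorem IsLayeredEigenfunction.lowering_mulVec (h : IsLayerFunction G x ℓ D) {g : X → ℂ}
    {β γ : ℕ → ℂ} (hg : IsLayeredEigenfunction G ℓ D g β γ) (i : ℕ) :
    Matrix.mulVec (loweringMatrix G x) (layerPart ℓ g (i + 1)) = γ i • layerPart ℓ g i := by
  classical
  ext y
  simp only [Matrix.mulVec, dotProduct, h.loweringMatrix_apply, layerPart, Pi.smul_apply,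
    smul_eq_mul]
  split_ifs with hy
  · rw [← hy, ← hg.sum_upper]
    refine Finset.sum_congr rfl fun z _ => ?_
    grind
  · rw [mul_zero]
    refine Finset.sum_eq_zero fun z _ => ?_
    grind

theorem IsLayeredEigenfunction.raising_mulVec (h : IsLayerFunction G x ℓ D) {g : X → ℂ}
    {β γ : ℕ → ℂ} (hg : IsLayeredEigenfunction G ℓ D g β γ) (i : ℕ) :
    Matrix.mulVec (raisingMatrix G x) (layerPart ℓ g i)
      = β (i + 1) • layerPart ℓ g (i + 1) := by
  classical
  ext y
  simp only [Matrix.mulVec, dotProduct, h.raisingMatrix_apply, layerPart, Pi.smul_apply,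
    smul_eq_mul]
  split_ifs with hy
  · rw [← hy, ← hg.sum_lower]
    refine Finset.sum_congr rfl fun z _ => ?_
    grind
  · rw [mul_zero]
    refine Finset.sum_eq_zero fun z _ => ?_
    grind

/-- The linear equation that a uniform structure imposes on the products
`γ (i - 1) * β i` of a layered eigenfunction. -/
theorem IsUniformStructure.eigenfunction_equation (h : IsLayerFunction G x ℓ D)
    {U : Matrix (Fin (graphEcc G x)) (Fin (graphEcc G x)) ℂ} {f : Fin (graphEcc G x) → ℂ}
    (hU : IsUniformStructure G x U f) {g : X → ℂ}
    {β γ : ℕ → ℂ} (hg : IsLayeredEigenfunction G ℓ D g β γ) (k : Fin (graphEcc G x))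
    (i : ℕ) (hk : (k : ℕ) = i + 1) (hi : i + 3 ≤ D) :
    eMinus U k * (γ i * β (i + 1)) + γ (i + 1) * β (i + 2)
      + ePlus U k * (γ (i + 2) * β (i + 3)) = f k := by
  -- Since `k = i + 1` counts from zero, the relation acts on layer `i + 2`, and its image lies in
  -- layer `i + 1`.
  have key := hU.uniform k _ (h.layerPart_mem g _)
  simp only [hk, Matrix.add_mulVec, Matrix.smul_mulVec, ← Matrix.mulVec_mulVec, pow_two,
    hg.lowering_mulVec h, hg.raising_mulVec h, Matrix.mulVec_smul, smul_smul] at key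
  obtain ⟨y, hy, hgy⟩ := hg.exists_ne_zero (i + 1) (by omega) (by omega)
  have hγ := hg.gamma_ne_zero (i + 1) (by omega) (by omega)
  have := congrFun key y
  simp only [Pi.add_apply, Pi.smul_apply, smul_eq_mul, layerPart, hy, if_true] at this
  -- Each of the three words contains one lowering from layer `i + 2` to layer `i + 1`, so `γ (i +
  -- 1) * g y` divides every term.
  refine mul_left_cancel₀ (mul_ne_zero hγ hgy) ?_
  linear_combination this

end Matrices

/-! ### Tridiagonal linear systems given by a parameter matrix -/

theorem IsParameterMatrix.sum_row {N : ℕ} {U : Matrix (Fin N) (Fin N) ℂ}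
    (hU : IsParameterMatrix U) (d : ℕ → ℂ) (k : Fin N) (i : ℕ) (hk : (k : ℕ) = i + 1)
    (hi : i + 2 < N) :
    ∑ j, U k j * d j = eMinus U k * d i + d (i + 1) + ePlus U k * d (i + 2) := by
  have hm : eMinus U k = U k ⟨i, by omega⟩ := by
    rw [eMinus, if_pos (by omega)]
    congr 2
    omega
  have hp : ePlus U k = U k ⟨i + 2, hi⟩ := by
    rw [ePlus, dif_pos (by omega)]
    congr 2
    omega
  have hd : U k ⟨i + 1, by omega⟩ = 1 := by
    rw [← hU.diag_eq_one k]
    congr 1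
    exact Fin.ext hk.symm
  have hs : ∑ j, U k j * d j
      = ∑ j ∈ ({⟨i, by omega⟩, ⟨i + 1, by omega⟩, ⟨i + 2, hi⟩} : Finset (Fin N)), U k j * d j := by
    symm
    refine Finset.sum_subset (Finset.subset_univ _) fun j _ hj => ?_
    simp only [Finset.mem_insert, Finset.mem_singleton, Fin.ext_iff, not_or] at hj
    rw [hU.tridiagonal k j (by omega), zero_mul]
  rw [hs, Finset.sum_insert (by simp), Finset.sum_pair (by simp), hm, hp, hd]
  ring

/-- The values `d 1, …, d (N - 2)` are determined by the rows `1, …, N - 2` of the linear system. -/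
theorem IsParameterMatrix.eq_zero_of_rows {N : ℕ} {U : Matrix (Fin N) (Fin N) ℂ}
    (hU : IsParameterMatrix U) (hN : 3 ≤ N) (d : ℕ → ℂ) (h0 : d 0 = 0) (hlast : d (N - 1) = 0)
    (hrow : ∀ (k : Fin N) (i : ℕ), (k : ℕ) = i + 1 → i + 2 < N →
      eMinus U k * d i + d (i + 1) + ePlus U k * d (i + 2) = 0) :
    d 1 = 0 := by
  let s : Fin N := ⟨1, by omega⟩
  let t : Fin N := ⟨N - 2, by omega⟩
  have hst : s ≤ t := by simp only [s, t, Fin.mk_le_mk]; omega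
  have hz := Matrix.eq_zero_of_mulVec_eq_zero (hU.principal_nonsingular s t hst)
    (v := fun j => d j.1) (by
      ext ⟨k, hk1, hk2⟩
      simp only [s, t, Fin.le_def] at hk1 hk2
      have hr := hrow k (k - 1) (by omega) (by omega)
      rw [← hU.sum_row d k (k - 1) (by omega) (by omega)] at hr
      simp only [Matrix.mulVec, dotProduct, Matrix.submatrix_apply, Pi.zero_apply]
      rw [← hr, ← Finset.sum_subtype (Finset.univ.filter fun j => s ≤ j ∧ j ≤ t) (by simp)
        (fun j => U k j * d j)]
      -- The only columns outside the submatrix are `0` and `N - 1`, where `d` vanishes, so the full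
      -- row and the truncated row give the same sum.
      refine Finset.sum_subset (Finset.subset_univ _) fun j _ hj => ?_
      simp only [Finset.mem_filter, Finset.mem_univ, true_and, s, t, Fin.le_def] at hj
      obtain hj | hj : (j : ℕ) = 0 ∨ (j : ℕ) = N - 1 := by omega
      · rw [hj, h0, mul_zero]
      · rw [hj, hlast, mul_zero])
  exact congrFun hz ⟨s, le_rfl, hst⟩

/-- A graph with two layered eigenfunctions whose parameters differ at the second layer does not
support a uniform structure. -/
theorem not_supportsUniformStructure_of_eigenfunctions {X : Type*} [Fintype X] [DecidableEq X]
    {Γ : SimpleGraph X} {x : X} {ℓ : X → ℕ} {D : ℕ} (hD : 3 ≤ D) (h : IsLayerFunction Γ x ℓ D)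
    {g g' : X → ℂ} {β γ β' γ' : ℕ → ℂ} (hg : IsLayeredEigenfunction Γ ℓ D g β γ)
    (hg' : IsLayeredEigenfunction Γ ℓ D g' β' γ') (hne : γ 1 * β 2 ≠ γ' 1 * β' 2) :
    ¬ SupportsUniformStructure Γ x := by
  rintro ⟨U, f, hU⟩
  have hD' := h.flatDeleted.graphEcc_eq
  -- Subtracting the equations of the two eigenfunctions eliminates the unknown `f`.
  refine hne (sub_eq_zero.1 (hU.isParameterMatrix.eq_zero_of_rows (by omega)
    (fun i => γ i * β (i + 1) - γ' i * β' (i + 1)) ?_ ?_ fun k i hk hi => ?_))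
  · simp [hg.beta_one, hg'.beta_one]
  · simp [hD', hg.gamma_last, hg'.gamma_last]
  · have h1 := hU.eigenfunction_equation h.flatDeleted (hg.flatDeleted h) k i hk (by omega)
    have h2 := hU.eigenfunction_equation h.flatDeleted (hg'.flatDeleted h) k i hk (by omega)
    linear_combination h1 - h2

/-! ## Eigenfunctions on the Boolean lattice -/

section Boolean

variable {α : Type*} [DecidableEq α]

/-- On the subsets `A` of `S`, the function `φ` is an eigenfunction of summing over the sets
covered by `A`, and over the sets covering `A`, with eigenvalues that depend on `A.card` only. -/
structure IsSetEigenfunction (S : Finset α) (φ : Finset α → ℂ) (p q : ℕ → ℂ) : Prop where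
  sum_erase : ∀ A ⊆ S, ∑ a ∈ A, φ (A.erase a) = p A.card * φ A
  sum_insert : ∀ A ⊆ S, ∑ a ∈ S \ A, φ (insert a A) = q A.card * φ A

theorem isSetEigenfunction_one (S : Finset α) :
    IsSetEigenfunction S (fun _ => 1) (fun k => k) (fun k => S.card - k) where
  sum_erase A _ := by simp
  sum_insert A hA := by simp [Finset.card_sdiff_of_subset hA, Nat.cast_sub (Finset.card_le_card hA)]

theorem sum_sdiff_eq_neg {S A : Finset α} (hA : A ⊆ S) {e : α → ℂ} (he : ∑ a ∈ S, e a = 0) :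
    ∑ a ∈ S \ A, e a = -∑ a ∈ A, e a := by
  rw [eq_neg_iff_add_eq_zero, Finset.sum_sdiff hA, he]

/-- Each element of `A` survives `A.card - 1` of the deletions. For insertions, the new elements
together contribute the weight of `S \ A`, which is minus that of `A`. -/
theorem isSetEigenfunction_sum {S : Finset α} {e : α → ℂ} (he : ∑ a ∈ S, e a = 0) :
    IsSetEigenfunction S (fun A => ∑ a ∈ A, e a) (fun k => k - 1) (fun k => S.card - k - 1) where
  sum_erase A _ := by
    rw [Finset.sum_congr rfl fun a ha => Finset.sum_erase_eq_sub ha]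
    simp only [Finset.sum_sub_distrib, Finset.sum_const, nsmul_eq_mul]
    ring
  sum_insert A hA := by
    rw [Finset.sum_congr rfl fun a ha => Finset.sum_insert (Finset.mem_sdiff.1 ha).2]
    simp only [Finset.sum_add_distrib, Finset.sum_const, nsmul_eq_mul, sum_sdiff_eq_neg hA he,
      Finset.card_sdiff_of_subset hA, Nat.cast_sub (Finset.card_le_card hA)]
    ring

/-- Changing `A` by one point changes the product by two linear terms and `e a * e' a`; disjoint
supports kill the latter, and each linear term sums to a multiple of the product. -/
theorem isSetEigenfunction_sum_mul_sum {S : Finset α} {e e' : α → ℂ} (he : ∑ a ∈ S, e a = 0)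
    (he' : ∑ a ∈ S, e' a = 0) (hee' : ∀ a, e a * e' a = 0) :
    IsSetEigenfunction S (fun A => (∑ a ∈ A, e a) * ∑ a ∈ A, e' a) (fun k => k - 2)
      (fun k => S.card - k - 2) where
  sum_erase A _ := by
    have h : ∀ a ∈ A, (∑ b ∈ A.erase a, e b) * ∑ b ∈ A.erase a, e' b
        = (∑ b ∈ A, e b) * (∑ b ∈ A, e' b) - e a * (∑ b ∈ A, e' b) - (∑ b ∈ A, e b) * e' a := by
      intro a ha
      rw [Finset.sum_erase_eq_sub ha, Finset.sum_erase_eq_sub ha]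
      linear_combination hee' a
    rw [Finset.sum_congr rfl h]
    simp only [Finset.sum_sub_distrib, Finset.sum_const, nsmul_eq_mul, ← Finset.sum_mul,
      ← Finset.mul_sum]
    ring
  sum_insert A hA := by
    have h : ∀ a ∈ S \ A, (∑ b ∈ insert a A, e b) * ∑ b ∈ insert a A, e' b
        = (∑ b ∈ A, e b) * (∑ b ∈ A, e' b) + e a * (∑ b ∈ A, e' b) + (∑ b ∈ A, e b) * e' a := by
      intro a ha
      rw [Finset.sum_insert (Finset.mem_sdiff.1 ha).2, Finset.sum_insert (Finset.mem_sdiff.1 ha).2]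
      linear_combination hee' a
    rw [Finset.sum_congr rfl h]
    simp only [Finset.sum_add_distrib, Finset.sum_const, nsmul_eq_mul, ← Finset.sum_mul,
      ← Finset.mul_sum, sum_sdiff_eq_neg hA he, sum_sdiff_eq_neg hA he',
      Finset.card_sdiff_of_subset hA, Nat.cast_sub (Finset.card_le_card hA)]
    ring

/-- The difference of the characteristic functions of two points. -/
def pointDiff (a b : α) : α → ℂ := Pi.single a 1 - Pi.single b 1

theorem sum_pointDiff (a b : α) (A : Finset α) :
    ∑ c ∈ A, pointDiff a b c = (if a ∈ A then 1 else 0) - (if b ∈ A then 1 else 0) := by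
  simp [pointDiff, Finset.sum_sub_distrib, Pi.single_apply]

theorem sum_pointDiff_eq_zero {a b : α} {A : Finset α} (ha : a ∈ A) (hb : b ∈ A) :
    ∑ c ∈ A, pointDiff a b c = 0 := by
  simp [sum_pointDiff, ha, hb]

end Boolean

/-! ## Johnson graphs -/

section Johnson

variable {n d : ℕ}

theorem johnsonGraph_adj_iff (s t : {s : Finset (Fin n) // s.card = d}) :
    (johnsonGraph n d).Adj s t ↔ ∃ a ∉ s.1, ∃ b ∈ s.1, t.1 = insert a (s.1.erase b) := by
  obtain ⟨s, hs⟩ := s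
  obtain ⟨t, ht⟩ := t
  simp only [johnsonGraph]
  constructor
  · intro h
    have h1 : (t \ s).card = 1 := by
      have := Finset.card_sdiff_add_card_inter t s
      rw [Finset.inter_comm] at this
      omega
    have h2 : (s \ t).card = 1 := by
      have := Finset.card_sdiff_add_card_inter s t
      omega
    obtain ⟨a, ha⟩ := Finset.card_eq_one.1 h1
    obtain ⟨b, hb⟩ := Finset.card_eq_one.1 h2
    simp only [Finset.ext_iff, Finset.mem_sdiff, Finset.mem_singleton] at ha hb
    refine ⟨a, ((ha a).2 rfl).2, b, ((hb b).2 rfl).1, ?_⟩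
    ext c
    simp only [Finset.mem_insert, Finset.mem_erase]
    have := ha c
    have := hb c
    tauto
  · rintro ⟨a, ha, b, hb, rfl⟩
    have : s ∩ insert a (s.erase b) = s.erase b := by
      ext c
      simp only [Finset.mem_inter, Finset.mem_insert, Finset.mem_erase]
      grind
    rw [this, Finset.card_erase_of_mem hb, hs]
    have := Finset.card_pos.2 ⟨b, hb⟩
    omega

theorem card_insert_erase {α : Type*} [DecidableEq α] {s : Finset α} {a b : α} (ha : a ∉ s)
    (hb : b ∈ s) : (insert a (s.erase b)).card = s.card := by
  rw [Finset.card_insert_of_notMem (by simp [ha]), Finset.card_erase_add_one hb]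

/-- Neighbours of `s` correspond bijectively to swaps of some `b ∈ s` for some `a ∉ s`. When `P`
selects a rectangle of swaps, the sum becomes a double sum that can factorise. -/
theorem johnsonGraph_sum_neighbors (s : {s : Finset (Fin n) // s.card = d})
    (P : Finset (Fin n) → Prop) [∀ t, Decidable ((johnsonGraph n d).Adj s t ∧ P t.1)] (A B : Finset (Fin n)) (hA : Disjoint A s.1) (hB : B ⊆ s.1)
    (hP : ∀ a ∉ s.1, ∀ b ∈ s.1, P (insert a (s.1.erase b)) ↔ a ∈ A ∧ b ∈ B)
    (G : Finset (Fin n) → ℂ) :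
    ∑ t, (if (johnsonGraph n d).Adj s t ∧ P t.1 then G t.1 else 0)
      = ∑ a ∈ A, ∑ b ∈ B, G (insert a (s.1.erase b)) := by
  rw [← Finset.sum_filter, ← Finset.sum_product']
  have hA' : ∀ a ∈ A, a ∉ s.1 := fun a ha => Finset.disjoint_left.1 hA ha
  symm
  refine Finset.sum_bij (fun ab hab => ⟨insert ab.1 (s.1.erase ab.2), ?_⟩) ?_ ?_ ?_ ?_
  · rw [Finset.mem_product] at hab
    rw [card_insert_erase (hA' _ hab.1) (hB hab.2), s.2]
  · rintro ⟨a, b⟩ hab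
    simp only [Finset.mem_product] at hab
    simp only [Finset.mem_filter, Finset.mem_univ, true_and, johnsonGraph_adj_iff]
    exact ⟨⟨a, hA' a hab.1, b, hB hab.2, rfl⟩, (hP a (hA' a hab.1) b (hB hab.2)).2 hab⟩
  · rintro ⟨a, b⟩ hab ⟨a', b'⟩ hab' heq
    simp only [Finset.mem_product] at hab hab'
    simp only [Subtype.mk.injEq, Finset.ext_iff, Finset.mem_insert, Finset.mem_erase] at heq
    have h1 := heq a
    have h2 := heq b
    have h3 := hA' a hab.1
    have h4 := hA' a' hab'.1
    have h5 := hB hab.2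
    have h6 := hB hab'.2
    ext1 <;> grind
  · intro t ht
    simp only [Finset.mem_filter, Finset.mem_univ, true_and, johnsonGraph_adj_iff] at ht
    obtain ⟨⟨a, ha, b, hb, hab⟩, hPt⟩ := ht
    rw [hab, hP a ha b hb] at hPt
    exact ⟨(a, b), Finset.mem_product.2 hPt, Subtype.ext hab.symm⟩
  · intros
    rfl

theorem sdiff_insert_erase_of_notMem {α : Type*} [DecidableEq α] {x s : Finset α} {a b : α}
    (hb : b ∉ x) : x \ insert a (s.erase b) = (x \ s).erase a := by
  grind

theorem sdiff_insert_erase_of_notMem_of_mem {α : Type*} [DecidableEq α] {x s : Finset α} {a b : α}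
    (ha : a ∉ x) (hb : b ∈ x) : x \ insert a (s.erase b) = insert b (x \ s) := by
  grind

theorem insert_erase_sdiff_of_mem {α : Type*} [DecidableEq α] {x s : Finset α} {a b : α}
    (ha : a ∈ x) : insert a (s.erase b) \ x = (s \ x).erase b := by
  grind

theorem insert_erase_sdiff_of_notMem_of_mem {α : Type*} [DecidableEq α] {x s : Finset α} {a b : α}
    (ha : a ∉ x) (hb : b ∈ x) : insert a (s.erase b) \ x = insert a (s \ x) := by
  grind

theorem card_sdiff_insert_erase {α : Type*} [DecidableEq α] {x s : Finset α} {a b : α}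
    (ha : a ∉ s) (hb : b ∈ s) :
    (x \ insert a (s.erase b)).card + (if a ∈ x then 1 else 0)
      = (x \ s).card + (if b ∈ x then 1 else 0) := by
  by_cases hax : a ∈ x <;> by_cases hbx : b ∈ x
  · have h : x \ insert a (s.erase b) = insert b ((x \ s).erase a) := by grind
    have h' : b ∉ (x \ s).erase a := by grind
    rw [h, Finset.card_insert_of_notMem h', Finset.card_erase_add_one (by grind)]
    simp [hax, hbx]
  · rw [sdiff_insert_erase_of_notMem hbx]
    simp only [hax, hbx, if_true, if_false]
    rw [Finset.card_erase_add_one (by grind), add_zero]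
  · rw [sdiff_insert_erase_of_notMem_of_mem hax hbx, Finset.card_insert_of_notMem (by grind)]
    simp [hax, hbx]
  · have h : x \ insert a (s.erase b) = x \ s := by grind
    simp [h, hax, hbx]

theorem johnsonGraph_isLayerFunction (D : ℕ) (x : {s : Finset (Fin (2 * D)) // s.card = D}) :
    IsLayerFunction (johnsonGraph (2 * D) D) x (fun s => (x.1 \ s.1).card) D where
  eq_of_zero s hs := by
    rw [Finset.card_eq_zero, Finset.sdiff_eq_empty_iff_subset] at hs
    exact Subtype.ext (Finset.eq_of_subset_of_card_le hs (by rw [x.2, s.2])).symm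
  base := by simp
  le_succ s t hst := by
    obtain ⟨a, ha, b, hb, h⟩ := (johnsonGraph_adj_iff s t).1 hst
    have := card_sdiff_insert_erase (x := x.1) ha hb
    rw [← h] at this
    split_ifs at this <;> omega
  exists_pred s hs := by
    obtain ⟨a, ha⟩ := Finset.card_pos.1 (Nat.pos_of_ne_zero hs)
    have hs' : (s.1 \ x.1).card ≠ 0 := by
      rwa [Finset.card_sdiff_comm (by rw [x.2, s.2])]
    obtain ⟨b, hb⟩ := Finset.card_pos.1 (Nat.pos_of_ne_zero hs')
    rw [Finset.mem_sdiff] at ha hb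
    refine ⟨⟨insert a (s.1.erase b), by rw [card_insert_erase ha.2 hb.1, s.2]⟩,
      ((johnsonGraph_adj_iff _ _).2 ⟨a, ha.2, b, hb.1, rfl⟩).symm, ?_⟩
    have := card_sdiff_insert_erase (x := x.1) ha.2 hb.1
    simpa [ha.1, hb.2] using this
  le_max s := (Finset.card_le_card Finset.sdiff_subset).trans x.2.le
  exists_max := ⟨⟨x.1ᶜ, by rw [Finset.card_compl, x.2, Fintype.card_fin]; omega⟩, by
    have : x.1 \ x.1ᶜ = x.1 := by simp
    rw [this, x.2]⟩

/-- Under `s ↦ (x \ s, s \ x)`, layer `i` consists of the pairs of `i`-subsets of `x` and of its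
complement. One step down or up deletes or inserts a point in both components independently, so
eigenfunctions multiply and so do their eigenvalues. -/
theorem johnsonGraph_isLayeredEigenfunction (D : ℕ)
    (x : {s : Finset (Fin (2 * D)) // s.card = D}) {φ ψ : Finset (Fin (2 * D)) → ℂ}
    {p q p' q' : ℕ → ℂ} (hφ : IsSetEigenfunction x.1 φ p q)
    (hψ : IsSetEigenfunction x.1ᶜ ψ p' q') (hp : p 1 = 0) (hq : q (D - 1) = 0)
    (hq0 : ∀ i, 1 ≤ i → i + 2 ≤ D → q i * q' i ≠ 0)
    (hφ0 : ∀ i, 1 ≤ i → i + 2 ≤ D → ∃ A ⊆ x.1, A.card = i ∧ φ A ≠ 0)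
    (hψ0 : ∀ i, 1 ≤ i → i + 2 ≤ D → ∃ A ⊆ x.1ᶜ, A.card = i ∧ ψ A ≠ 0) :
    IsLayeredEigenfunction (johnsonGraph (2 * D) D) (fun s => (x.1 \ s.1).card) D
      (fun s => φ (x.1 \ s.1) * ψ (s.1 \ x.1)) (fun i => p i * p' i) (fun i => q i * q' i) where
  sum_lower s := by
    classical
    have hc : (s.1 \ x.1).card = (x.1 \ s.1).card := Finset.card_sdiff_comm (by rw [x.2, s.2])
    rw [johnsonGraph_sum_neighbors s (fun t => (x.1 \ t).card + 1 = (x.1 \ s.1).card)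
      (x.1 \ s.1) (s.1 \ x.1) Finset.sdiff_disjoint Finset.sdiff_subset _
      (fun t => φ (x.1 \ t) * ψ (t \ x.1))]
    · have hE : ∀ a ∈ x.1 \ s.1, ∀ b ∈ s.1 \ x.1,
          φ (x.1 \ insert a (s.1.erase b)) * ψ (insert a (s.1.erase b) \ x.1)
            = φ ((x.1 \ s.1).erase a) * ψ ((s.1 \ x.1).erase b) := by
        intro a ha b hb
        rw [Finset.mem_sdiff] at ha hb
        rw [sdiff_insert_erase_of_notMem hb.2,
          insert_erase_sdiff_of_mem ha.1]
      rw [Finset.sum_congr rfl fun a ha => Finset.sum_congr rfl (hE a ha), ← Finset.sum_mul_sum,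
        hφ.sum_erase _ Finset.sdiff_subset, hψ.sum_erase _ (by grind [Finset.mem_compl]), hc]
      ring
    · intro a ha b hb
      have := card_sdiff_insert_erase (x := x.1) ha hb
      simp only [Finset.mem_sdiff, ha, hb]
      split_ifs at this <;> simp [*] <;> omega
  sum_upper s := by
    classical
    have hc : (s.1 \ x.1).card = (x.1 \ s.1).card := Finset.card_sdiff_comm (by rw [x.2, s.2])
    rw [johnsonGraph_sum_neighbors s (fun t => (x.1 \ t).card = (x.1 \ s.1).card + 1)
      (x.1ᶜ \ (s.1 \ x.1)) (x.1 \ (x.1 \ s.1)) _ _ _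
      (fun t => φ (x.1 \ t) * ψ (t \ x.1))]
    · have hE : ∀ a ∈ x.1ᶜ \ (s.1 \ x.1), ∀ b ∈ x.1 \ (x.1 \ s.1),
          φ (x.1 \ insert a (s.1.erase b)) * ψ (insert a (s.1.erase b) \ x.1)
            = ψ (insert a (s.1 \ x.1)) * φ (insert b (x.1 \ s.1)) := by
        intro a ha b hb
        rw [Finset.mem_sdiff, Finset.mem_compl] at ha
        rw [Finset.mem_sdiff] at hb
        rw [sdiff_insert_erase_of_notMem_of_mem ha.1 hb.1,
          insert_erase_sdiff_of_notMem_of_mem ha.1 hb.1, mul_comm]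
      rw [Finset.sum_congr rfl fun a ha => Finset.sum_congr rfl (hE a ha), ← Finset.sum_mul_sum,
        hφ.sum_insert _ Finset.sdiff_subset, hψ.sum_insert _ (by grind [Finset.mem_compl]), hc]
      ring
    · rw [Finset.disjoint_left]
      grind [Finset.mem_compl]
    · grind
    · intro a ha b hb
      have := card_sdiff_insert_erase (x := x.1) ha hb
      simp only [Finset.mem_sdiff, Finset.mem_compl, ha, hb]
      split_ifs at this <;> simp [*] <;> omega
  beta_one := by simp [hp]
  gamma_last := by simp [hq]
  gamma_ne_zero := hq0
  exists_ne_zero i hi hi' := by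
    obtain ⟨A, hA, hAi, hA0⟩ := hφ0 i hi hi'
    obtain ⟨B, hB, hBi, hB0⟩ := hψ0 i hi hi'
    have hB' : ∀ b ∈ B, b ∉ x.1 := fun b hb => Finset.mem_compl.1 (hB hb)
    have hdisj : Disjoint (x.1 \ A) B := by
      rw [Finset.disjoint_left]
      grind
    have h1 : x.1 \ (x.1 \ A ∪ B) = A := by grind
    have h2 : (x.1 \ A ∪ B) \ x.1 = B := by grind
    refine ⟨⟨x.1 \ A ∪ B, ?_⟩, ?_, ?_⟩
    · rw [Finset.card_union_of_disjoint hdisj, Finset.card_sdiff_of_subset hA, x.2, hAi, hBi]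
      omega
    · simp only [h1, hAi]
    · simp only [h1, h2]
      exact mul_ne_zero hA0 hB0

theorem exists_sum_pointDiff_ne_zero {α : Type*} [DecidableEq α] {S : Finset α} {a b : α}
    (ha : a ∈ S) (hb : b ∈ S) (hab : a ≠ b) {i : ℕ} (hi : 1 ≤ i) (hi' : i + 1 ≤ S.card) :
    ∃ A ⊆ S, A.card = i ∧ ∑ c ∈ A, pointDiff a b c ≠ 0 := by
  obtain ⟨A, h1, h2, h3⟩ := Finset.exists_subsuperset_card_eq (s := {a}) (t := S.erase b)
    (n := i) (by simp [ha, hab]) (by simpa using hi)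
    (by rw [Finset.card_erase_of_mem hb]; omega)
  have haA : a ∈ A := h1 (Finset.mem_singleton_self a)
  have hbA : b ∉ A := fun h => Finset.notMem_erase b S (h2 h)
  exact ⟨A, h2.trans (Finset.erase_subset _ _), h3, by simp [sum_pointDiff, haA, hbA]⟩

theorem natCast_sub_natCast_sub_one_ne_zero {m k : ℕ} (h : k + 2 ≤ m) : (m : ℂ) - k - 1 ≠ 0 := by
  obtain ⟨r, rfl⟩ := Nat.exists_eq_add_of_le h
  have : ((r + 1 : ℕ) : ℂ) ≠ 0 := by exact_mod_cast Nat.succ_ne_zero r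
  push_cast at this ⊢
  convert this using 1
  ring

theorem johnsonGraph_not_supportsUniformStructure {X : Type*} [Fintype X] [DecidableEq X]
    {Γ : SimpleGraph X} (x : X) {D : ℕ} (hD : 3 ≤ D) (e : Γ ≃g johnsonGraph (2 * D) D) :
    ¬ SupportsUniformStructure Γ x := by
  have hcard : (e x).1ᶜ.card = D := by
    rw [Finset.card_compl, (e x).2, Fintype.card_fin]
    omega
  obtain ⟨a, ha, a', ha', haa⟩ := Finset.one_lt_card.1 (show 1 < (e x).1.card by rw [(e x).2]; omega)
  obtain ⟨b, hb, b', hb', hbb⟩ := Finset.one_lt_card.1 (show 1 < (e x).1ᶜ.card by omega)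
  have hφ := isSetEigenfunction_sum (sum_pointDiff_eq_zero ha ha')
  have hψ := isSetEigenfunction_sum (sum_pointDiff_eq_zero hb hb')
  have hψ' := isSetEigenfunction_one (e x).1ᶜ
  rw [hcard] at hψ hψ'
  rw [(e x).2] at hφ
  have hDc : ((D - 1 : ℕ) : ℂ) = D - 1 := by rw [Nat.cast_sub (by omega), Nat.cast_one]
  have hφ0 : ∀ i, 1 ≤ i → i + 2 ≤ D →
      ∃ A ⊆ (e x).1, A.card = i ∧ ∑ c ∈ A, pointDiff a a' c ≠ 0 := fun i hi hi' =>
    exists_sum_pointDiff_ne_zero ha ha' haa hi (by rw [(e x).2]; omega)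
  have h1 := johnsonGraph_isLayeredEigenfunction D (e x) hφ hψ (by simp) (by simp [hDc])
    (fun i _ hi' => mul_ne_zero (natCast_sub_natCast_sub_one_ne_zero hi')
      (natCast_sub_natCast_sub_one_ne_zero hi')) hφ0
    (fun i hi hi' => exists_sum_pointDiff_ne_zero hb hb' hbb hi (by omega))
  have h2 := johnsonGraph_isLayeredEigenfunction D (e x) hφ hψ' (by simp) (by simp [hDc])
    (fun i _ hi' => mul_ne_zero (natCast_sub_natCast_sub_one_ne_zero hi') (by
      rw [sub_ne_zero]
      exact_mod_cast (show D ≠ i by omega))) hφ0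
    (fun i hi hi' => by
      obtain ⟨A, hA, hA'⟩ := Finset.exists_subset_card_eq (show i ≤ (e x).1ᶜ.card by omega)
      exact ⟨A, hA, hA', one_ne_zero⟩)
  refine not_supportsUniformStructure_of_eigenfunctions hD
    ((johnsonGraph_isLayerFunction D (e x)).comp_iso e) (h1.comp_iso e) (h2.comp_iso e) ?_
  -- The two values of `γ 1 * β 2` are `(D-2)²` and `2(D-2)(D-1)`; they differ by `D(D-2) =
  -- (r+3)(r+1)`.
  obtain ⟨r, rfl⟩ := Nat.exists_eq_add_of_le hD
  push_cast
  intro h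
  have h' : ((r + 1 : ℕ) : ℂ) * ((r + 3 : ℕ) : ℂ) = 0 := by
    push_cast
    linear_combination -h
  exact absurd (by exact_mod_cast h') (show (r + 1) * (r + 3) ≠ 0 by positivity)

end Johnson

/-! ## Halved cubes -/

section HalvedCube

variable {n : ℕ}

/-- The graph of the subsets of even cardinality of `Fin n`, two of them being adjacent when their
symmetric difference has two elements. -/
def evenSetGraph (n : ℕ) : SimpleGraph {s : Finset (Fin n) // Even s.card} where
  Adj s t := (symmDiff s.1 t.1).card = 2
  symm := ⟨fun s t h => by rw [symmDiff_comm]; exact h⟩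
  loopless := ⟨fun s h => by simp at h⟩

theorem hammingNorm_cast_eq_sum (v : Fin n → ZMod 2) : (hammingNorm v : ZMod 2) = ∑ i, v i := by
  have h : ∀ c : ZMod 2, (if c ≠ 0 then (1 : ZMod 2) else 0) = c := by decide
  rw [hammingNorm, Finset.card_filter, Nat.cast_sum]
  exact Finset.sum_congr rfl fun i _ => by simpa using h (v i)

theorem even_hammingNorm_iff (v : Fin n → ZMod 2) : Even (hammingNorm v) ↔ ∑ i, v i = 0 := by
  rw [← hammingNorm_cast_eq_sum, ZMod.natCast_eq_zero_iff_even]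

theorem even_hammingNorm_add {u v : Fin n → ZMod 2} (hu : Even (hammingNorm u))
    (hv : Even (hammingNorm v)) : Even (hammingNorm (u + v)) := by
  rw [even_hammingNorm_iff] at *
  simp [Finset.sum_add_distrib, hu, hv]

/-- The halved cube is isomorphic to the graph of even subsets, a given vertex being sent to the
empty set. -/
theorem exists_iso_evenSetGraph (x : {v : Fin n → ZMod 2 // Even (hammingNorm v)}) :
    ∃ e : halvedCube n ≃g evenSetGraph n, (e x).1 = ∅ := by
  let F : {v : Fin n → ZMod 2 // Even (hammingNorm v)} → {s : Finset (Fin n) // Even s.card} :=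
    fun v => ⟨Finset.univ.filter fun i => (v.1 + x.1) i ≠ 0, even_hammingNorm_add v.2 x.2⟩
  have hF : Function.Bijective F := by
    constructor
    · intro u v huv
      have h2 : ∀ a b c : ZMod 2, (a + c ≠ 0 ↔ b + c ≠ 0) → a = b := by decide
      ext i
      simp only [F, Subtype.mk.injEq, Finset.ext_iff, Finset.mem_filter, Finset.mem_univ,
        true_and, Pi.add_apply] at huv
      rw [h2 _ _ _ (huv i)]
    · intro s
      let w : Fin n → ZMod 2 := fun i => if i ∈ s.1 then 1 else 0
      have hw : Even (hammingNorm w) := by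
        have : hammingNorm w = s.1.card := by simp [hammingNorm, w]
        rw [this]
        exact s.2
      refine ⟨⟨w + x.1, even_hammingNorm_add hw x.2⟩, Subtype.ext ?_⟩
      have h2 : ∀ a c : ZMod 2, a + c + c = a := by decide
      ext i
      simp [F, h2, w]
  refine ⟨⟨Equiv.ofBijective F hF, ?_⟩, ?_⟩
  · intro u v
    have h2 : ∀ a b c : ZMod 2, ((a + c ≠ 0 ∧ ¬ b + c ≠ 0) ∨ (b + c ≠ 0 ∧ ¬ a + c ≠ 0)) ↔ a ≠ b := by
      decide
    have h : symmDiff (F u).1 (F v).1 = Finset.univ.filter fun i => u.1 i ≠ v.1 i := by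
      ext i
      simp only [F, Finset.mem_symmDiff, Finset.mem_filter, Finset.mem_univ, true_and,
        Pi.add_apply]
      exact h2 _ _ _
    change (symmDiff (F u).1 (F v).1).card = 2 ↔ hammingDist u.1 v.1 = 2
    rw [h, hammingDist]
  · have h2 : ∀ a : ZMod 2, a + a = 0 := by decide
    change (F x).1 = ∅
    simp [F, h2]

theorem card_symmDiff_eq {α : Type*} [DecidableEq α] (s t : Finset α) :
    (symmDiff s t).card = (s \ t).card + (t \ s).card :=
  Finset.card_union_of_disjoint disjoint_sdiff_sdiff

theorem card_add_card_sdiff_comm {α : Type*} [DecidableEq α] (s t : Finset α) :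
    s.card + (t \ s).card = t.card + (s \ t).card := by
  rw [add_comm, Finset.card_sdiff_add_card, add_comm, Finset.card_sdiff_add_card, Finset.union_comm]

/-- If `|s \ t| + |t \ s| = 2` while `|s| - |t| = 2`, then `t \ s` is empty. -/
theorem evenSetGraph_adj_lower_iff (s t : {s : Finset (Fin n) // Even s.card}) :
    (evenSetGraph n).Adj s t ∧ t.1.card / 2 + 1 = s.1.card / 2
      ↔ t.1 ⊆ s.1 ∧ t.1.card + 2 = s.1.card := by
  obtain ⟨s, hs⟩ := s
  obtain ⟨t, ht⟩ := t
  rw [Nat.even_iff] at hs ht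
  have h1 := card_symmDiff_eq s t
  have h2 := card_add_card_sdiff_comm s t
  simp only [evenSetGraph]
  rw [← Finset.sdiff_eq_empty_iff_subset, ← Finset.card_eq_zero]
  omega

theorem evenSetGraph_adj_upper_iff (s t : {s : Finset (Fin n) // Even s.card}) :
    (evenSetGraph n).Adj s t ∧ t.1.card / 2 = s.1.card / 2 + 1
      ↔ s.1 ⊆ t.1 ∧ t.1.card = s.1.card + 2 := by
  rw [SimpleGraph.adj_comm, eq_comm, evenSetGraph_adj_lower_iff, eq_comm]

/-- The two points of `s \ t` can be deleted in either order, which accounts for the factor 2 and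
for the halves in the halved cube's `β` and `γ`. -/
theorem sum_offDiag_erase {α : Type*} [DecidableEq α] [Fintype α] (s : Finset α)
    (G : Finset α → ℂ) :
    ∑ a ∈ s, ∑ b ∈ s.erase a, G ((s.erase a).erase b)
      = 2 * ∑ t with t ⊆ s ∧ t.card + 2 = s.card, G t := by
  have hoff : ∑ a ∈ s, ∑ b ∈ s.erase a, G ((s.erase a).erase b)
      = ∑ c ∈ s.offDiag, G ((s.erase c.1).erase c.2) := by
    symm
    refine Finset.sum_finset_product' _ _ _ (f := fun a b => G ((s.erase a).erase b)) ?_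
    rintro ⟨a, b⟩
    simp only [Finset.mem_offDiag, Finset.mem_erase]
    tauto
  rw [hoff, Finset.mul_sum, ← Finset.sum_fiberwise_of_maps_to
    (g := fun c : α × α => (s.erase c.1).erase c.2)
    (t := Finset.univ.filter fun t => t ⊆ s ∧ t.card + 2 = s.card)]
  · refine Finset.sum_congr rfl fun t ht => ?_
    simp only [Finset.mem_filter, Finset.mem_univ, true_and] at ht
    have hfib : (s.offDiag.filter fun c : α × α => (s.erase c.1).erase c.2 = t)
        = (s \ t).offDiag := by
      ext ⟨a, b⟩
      simp only [Finset.mem_filter, Finset.mem_offDiag, Finset.mem_sdiff]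
      constructor
      · rintro ⟨⟨ha, hb, hab⟩, rfl⟩
        simp [ha, hb, hab]
      · rintro ⟨⟨ha, ha'⟩, ⟨hb, hb'⟩, hab⟩
        refine ⟨⟨ha, hb, hab⟩, (Finset.eq_of_subset_of_card_le ?_ ?_).symm⟩
        · intro c hc
          have := ht.1 hc
          grind
        · have h1 := Finset.card_erase_add_one (show b ∈ s.erase a by grind)
          have h2 := Finset.card_erase_add_one ha
          omega
    rw [Finset.sum_congr rfl (g := fun _ => G t) fun c hc => by rw [(Finset.mem_filter.1 hc).2],
      Finset.sum_const, hfib, Finset.offDiag_card, Finset.card_sdiff_of_subset ht.1,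
      show s.card - t.card = 2 by omega]
    simp
  · rintro ⟨a, b⟩ hab
    simp only [Finset.mem_offDiag] at hab
    have hb : b ∈ s.erase a := by grind
    have h1 := Finset.card_erase_add_one hb
    have h2 := Finset.card_erase_add_one hab.1
    simp only [Finset.mem_filter, Finset.mem_univ, true_and]
    exact ⟨(Finset.erase_subset _ _).trans (Finset.erase_subset _ _), by omega⟩

/-- Complementation turns insertions into deletions. -/
theorem sum_offDiag_insert {α : Type*} [DecidableEq α] [Fintype α] (s : Finset α)
    (G : Finset α → ℂ) :
    ∑ a ∈ Finset.univ \ s, ∑ b ∈ Finset.univ \ insert a s, G (insert b (insert a s))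
      = 2 * ∑ t with s ⊆ t ∧ t.card = s.card + 2, G t := by
  have h := sum_offDiag_erase sᶜ fun t => G tᶜ
  have hc : ∑ t with t ⊆ sᶜ ∧ t.card + 2 = sᶜ.card, G tᶜ
      = ∑ t with s ⊆ t ∧ t.card = s.card + 2, G t := by
    refine Finset.sum_bij' (fun t _ => tᶜ) (fun t _ => tᶜ) ?_ ?_ ?_ ?_ ?_
    · intro t ht
      have h1 := Finset.card_add_card_compl t
      have h2 := Finset.card_add_card_compl s
      simp only [Finset.mem_filter, Finset.mem_univ, true_and] at ht ⊢
      exact ⟨Finset.subset_compl_comm.1 ht.1, by omega⟩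
    · intro t ht
      have h1 := Finset.card_add_card_compl t
      have h2 := Finset.card_add_card_compl s
      simp only [Finset.mem_filter, Finset.mem_univ, true_and] at ht ⊢
      exact ⟨Finset.compl_subset_compl.2 ht.1, by omega⟩
    all_goals simp
  rw [hc] at h
  rw [← h, ← Finset.compl_eq_univ_sdiff]
  refine Finset.sum_congr rfl fun a _ => ?_
  have he : Finset.univ \ insert a s = sᶜ.erase a := by
    ext c
    simp
  rw [he]
  refine Finset.sum_congr rfl fun b _ => ?_
  congr 1
  ext c
  simp only [Finset.mem_insert, Finset.mem_compl, Finset.mem_erase]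
  tauto

theorem evenSetGraph_isLayerFunction (D : ℕ) (x : {s : Finset (Fin (2 * D)) // Even s.card})
    (hx : x.1 = ∅) :
    IsLayerFunction (evenSetGraph (2 * D)) x (fun s => s.1.card / 2) D where
  eq_of_zero s hs := by
    have := Nat.even_iff.1 s.2
    refine Subtype.ext ?_
    rw [hx, ← Finset.card_eq_zero]
    omega
  base := by simp [hx]
  le_succ s t hst := by
    have h1 : (symmDiff s.1 t.1).card = 2 := hst
    have h2 := card_symmDiff_eq s.1 t.1
    have h3 := card_add_card_sdiff_comm s.1 t.1
    omega
  exists_pred s hs := by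
    obtain ⟨t, ht, ht'⟩ := Finset.exists_subset_card_eq (show s.1.card - 2 ≤ s.1.card by omega)
    have h := Nat.even_iff.1 s.2
    have h' := (evenSetGraph_adj_lower_iff s ⟨t, by rw [ht', Nat.even_iff]; omega⟩).2
      ⟨ht, by simp only [ht']; omega⟩
    exact ⟨_, h'.1.symm, h'.2⟩
  le_max s := by
    have := Finset.card_le_univ s.1
    rw [Fintype.card_fin] at this
    omega
  exists_max := ⟨⟨Finset.univ, by simp⟩, by simp⟩

/-- One layer step is two steps in the Boolean lattice, so the parameters are products of two
consecutive eigenvalues, halved for the order. -/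
theorem evenSetGraph_isLayeredEigenfunction {D : ℕ} {φ : Finset (Fin (2 * D)) → ℂ} {p q : ℕ → ℂ}
    (hφ : IsSetEigenfunction Finset.univ φ p q) (hp : p 2 * p 1 = 0)
    (hq : q (2 * (D - 1)) * q (2 * (D - 1) + 1) = 0)
    (hq0 : ∀ i, i + 2 ≤ D → q (2 * i) * q (2 * i + 1) ≠ 0)
    (hφ0 : ∀ i, 1 ≤ i → i + 2 ≤ D → ∃ A : Finset (Fin (2 * D)), A.card = 2 * i ∧ φ A ≠ 0) :
    IsLayeredEigenfunction (evenSetGraph (2 * D)) (fun s => s.1.card / 2) D (fun s => φ s.1)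
      (fun i => p (2 * i) * p (2 * i - 1) / 2) (fun i => q (2 * i) * q (2 * i + 1) / 2) where
  sum_lower s := by
    classical
    have hs := Nat.two_mul_div_two_of_even s.2
    have h1 : ∑ a ∈ s.1, ∑ b ∈ s.1.erase a, φ ((s.1.erase a).erase b)
        = p s.1.card * p (s.1.card - 1) * φ s.1 := by
      have : ∀ a ∈ s.1, ∑ b ∈ s.1.erase a, φ ((s.1.erase a).erase b)
          = p (s.1.card - 1) * φ (s.1.erase a) := fun a ha => by
        rw [hφ.sum_erase _ (Finset.subset_univ _), Finset.card_erase_of_mem ha]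
      rw [Finset.sum_congr rfl this, ← Finset.mul_sum, hφ.sum_erase _ (Finset.subset_univ _)]
      ring
    rw [sum_offDiag_erase] at h1
    have h2 : ∑ t, (if (evenSetGraph (2 * D)).Adj s t ∧ t.1.card / 2 + 1 = s.1.card / 2
        then φ t.1 else 0) = ∑ t with t ⊆ s.1 ∧ t.card + 2 = s.1.card, φ t := by
      simp only [evenSetGraph_adj_lower_iff]
      rw [← Finset.sum_filter]
      refine Finset.sum_bij (fun t _ => t.1) (by simp) (fun _ _ _ _ => Subtype.ext) ?_ (by simp)
      intro t ht
      have := Nat.even_iff.1 s.2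
      simp only [Finset.mem_filter, Finset.mem_univ, true_and] at ht
      exact ⟨⟨t, by rw [Nat.even_iff]; omega⟩,
        Finset.mem_filter.2 ⟨Finset.mem_univ _, ht⟩, rfl⟩
    rw [hs]
    convert h2.trans (show _ = p s.1.card * p (s.1.card - 1) / 2 * φ s.1 by
      linear_combination h1 / 2)
  sum_upper s := by
    classical
    have hs := Nat.two_mul_div_two_of_even s.2
    have h1 : ∑ a ∈ Finset.univ \ s.1, ∑ b ∈ Finset.univ \ insert a s.1, φ (insert b (insert a s.1))
        = q s.1.card * q (s.1.card + 1) * φ s.1 := by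
      have : ∀ a ∈ Finset.univ \ s.1, ∑ b ∈ Finset.univ \ insert a s.1, φ (insert b (insert a s.1))
          = q (s.1.card + 1) * φ (insert a s.1) := fun a ha => by
        rw [hφ.sum_insert _ (Finset.subset_univ _),
          Finset.card_insert_of_notMem (Finset.mem_sdiff.1 ha).2]
      rw [Finset.sum_congr rfl this, ← Finset.mul_sum, hφ.sum_insert _ (Finset.subset_univ _)]
      ring
    rw [sum_offDiag_insert] at h1
    have h2 : ∑ t, (if (evenSetGraph (2 * D)).Adj s t ∧ t.1.card / 2 = s.1.card / 2 + 1
        then φ t.1 else 0) = ∑ t with s.1 ⊆ t ∧ t.card = s.1.card + 2, φ t := by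
      simp only [evenSetGraph_adj_upper_iff]
      rw [← Finset.sum_filter]
      refine Finset.sum_bij (fun t _ => t.1) (by simp) (fun _ _ _ _ => Subtype.ext) ?_ (by simp)
      intro t ht
      have := Nat.even_iff.1 s.2
      simp only [Finset.mem_filter, Finset.mem_univ, true_and] at ht
      exact ⟨⟨t, by rw [Nat.even_iff]; omega⟩,
        Finset.mem_filter.2 ⟨Finset.mem_univ _, ht⟩, rfl⟩
    rw [hs]
    convert h2.trans (show _ = q s.1.card * q (s.1.card + 1) / 2 * φ s.1 by
      linear_combination h1 / 2)
  beta_one := by simpa using hp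
  gamma_last := by simpa using hq
  gamma_ne_zero i _ hi := div_ne_zero (hq0 i hi) two_ne_zero
  exists_ne_zero i hi hi' := by
    obtain ⟨A, hA, hA'⟩ := hφ0 i hi hi'
    exact ⟨⟨A, by simp [hA]⟩, by simp [hA], hA'⟩

theorem natCast_sub_natCast_sub_two_ne_zero {m k : ℕ} (h : k + 3 ≤ m) : (m : ℂ) - k - 2 ≠ 0 := by
  have := natCast_sub_natCast_sub_one_ne_zero (show k + 1 + 2 ≤ m by omega)
  convert this using 1
  push_cast
  ring

theorem halvedCube_not_supportsUniformStructure {X : Type*} [Fintype X] [DecidableEq X]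
    {Γ : SimpleGraph X} (x : X) {D : ℕ} (hD : 3 ≤ D) (e : Γ ≃g halvedCube (2 * D)) :
    ¬ SupportsUniformStructure Γ x := by
  obtain ⟨e', he'⟩ := exists_iso_evenSetGraph (e x)
  let pt (i : ℕ) (hi : i < 6) : Fin (2 * D) := ⟨i, by omega⟩
  let e₁ := pointDiff (pt 0 (by omega)) (pt 1 (by omega))
  let e₂ := pointDiff (pt 2 (by omega)) (pt 3 (by omega))
  have hs₁ : ∑ c, e₁ c = 0 := sum_pointDiff_eq_zero (Finset.mem_univ _) (Finset.mem_univ _)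
  have hs₂ : ∑ c, e₂ c = 0 := sum_pointDiff_eq_zero (Finset.mem_univ _) (Finset.mem_univ _)
  have hs : ∀ c, e₁ c * e₂ c = 0 := by
    intro c
    simp only [e₁, e₂, pointDiff, Pi.sub_apply, Pi.single_apply, pt, Fin.ext_iff]
    split_ifs <;> first | omega | simp
  have hφ := isSetEigenfunction_sum hs₁
  have hψ := isSetEigenfunction_sum_mul_sum hs₁ hs₂ hs
  rw [Finset.card_univ, Fintype.card_fin] at hφ hψ
  have hex : ∀ i, 1 ≤ i → i + 2 ≤ D → ∃ A : Finset (Fin (2 * D)), A.card = 2 * i ∧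
      ∑ c ∈ A, e₁ c = 1 ∧ ∑ c ∈ A, e₂ c = 1 := by
    intro i hi hi'
    obtain ⟨A, h1, h2, h3⟩ := Finset.exists_subsuperset_card_eq
      (s := {pt 0 (by omega), pt 2 (by omega)})
      (t := (Finset.univ.erase (pt 1 (by omega))).erase (pt 3 (by omega))) (n := 2 * i)
      (by
        intro c hc
        simp only [Finset.mem_insert, Finset.mem_singleton] at hc
        rcases hc with rfl | rfl <;> simp [pt])
      (Finset.card_le_two.trans (by omega))
      (by
        rw [Finset.card_erase_of_mem (by simp [pt]), Finset.card_erase_of_mem (by simp),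
          Finset.card_univ, Fintype.card_fin]
        omega)
    have m0 : pt 0 (by omega) ∈ A := h1 (by simp)
    have m2 : pt 2 (by omega) ∈ A := h1 (by simp)
    have m1 : pt 1 (by omega) ∉ A := fun h => by simpa using h2 h
    have m3 : pt 3 (by omega) ∉ A := fun h => by simpa using h2 h
    exact ⟨A, h3, by simp [e₁, sum_pointDiff, m0, m1], by simp [e₂, sum_pointDiff, m2, m3]⟩
  have hDc : ((D - 1 : ℕ) : ℂ) = D - 1 := by rw [Nat.cast_sub (by omega), Nat.cast_one]
  -- The end conditions hold for the linear function because `p 1 = 0` and `q (2D-1) = 0`, and for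
  -- the quadratic one because `p 2 = 0` and `q (2D-2) = 0`.
  have h1 := evenSetGraph_isLayeredEigenfunction hφ (by simp)
    (by push_cast; rw [hDc]; ring)
    (fun i hi => mul_ne_zero (natCast_sub_natCast_sub_one_ne_zero (by omega))
      (natCast_sub_natCast_sub_one_ne_zero (by omega)))
    (fun i hi hi' => by
      obtain ⟨A, hA, hA₁, -⟩ := hex i hi hi'
      exact ⟨A, hA, by rw [hA₁]; exact one_ne_zero⟩)
  have h2 := evenSetGraph_isLayeredEigenfunction hψ (by simp)
    (by push_cast; rw [hDc]; ring)
    (fun i hi => mul_ne_zero (natCast_sub_natCast_sub_two_ne_zero (by omega))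
      (natCast_sub_natCast_sub_two_ne_zero (by omega)))
    (fun i hi hi' => by
      obtain ⟨A, hA, hA₁, hA₂⟩ := hex i hi hi'
      exact ⟨A, hA, by rw [hA₁, hA₂, mul_one]; exact one_ne_zero⟩)
  refine not_supportsUniformStructure_of_eigenfunctions hD
    ((evenSetGraph_isLayerFunction D (e' (e x)) he').comp_iso (e.trans e')) (h1.comp_iso (e.trans e'))
    (h2.comp_iso (e.trans e')) ?_
  -- The values of `γ 1 * β 2` are `3(2D-3)(D-2)` and `(D-2)(2D-5)`; they differ by `4(D-2)(D-1)`.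
  obtain ⟨r, rfl⟩ := Nat.exists_eq_add_of_le hD
  push_cast
  intro h
  have h' : ((r + 1 : ℕ) : ℂ) * ((r + 2 : ℕ) : ℂ) = 0 := by
    push_cast
    linear_combination h / 4
  exact absurd (by exact_mod_cast h') (show (r + 1) * (r + 2) ≠ 0 by positivity)

end HalvedCube

/-! ## The Gosset graph -/

section Gosset

instance gossetGraph_decidableAdj : DecidableRel gossetGraph.Adj := fun u v =>
  inferInstanceAs (Decidable
    ((u.1 = v.1 ∧ (u.2.1 ∩ v.2.1).card = 1) ∨ (u.1 ≠ v.1 ∧ Disjoint u.2.1 v.2.1)))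

/-- A fixed vertex of the Gosset graph. -/
def gossetBase : Bool × {s : Finset (Fin 8) // s.card = 2} := (false, ⟨{0, 1}, rfl⟩)

/-- The distance from `gossetBase`. -/
def gossetLayer (y : Bool × {s : Finset (Fin 8) // s.card = 2}) : ℕ :=
  if y.1 then 1 + (y.2.1 ∩ {0, 1}).card else 2 - (y.2.1 ∩ {0, 1}).card

/-- The difference of the indicators of membership of two points. -/
def gossetDiff (a b : Fin 8) (y : Bool × {s : Finset (Fin 8) // s.card = 2}) : ℤ :=
  (if a ∈ y.2.1 then 1 else 0) - (if b ∈ y.2.1 then 1 else 0)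

theorem gossetGraph_isLayerFunction : IsLayerFunction gossetGraph gossetBase gossetLayer 3 where
  eq_of_zero := by decide +kernel
  base := by decide +kernel
  le_succ := by decide +kernel
  exists_pred := by decide +kernel
  le_max := by decide +kernel
  exists_max := by decide +kernel

/-- With `D = 3` only the passage between layers 1 and 2 matters, and `γ 1 = β 2 = θ`. Integer
values keep the hypotheses decidable. -/
theorem gossetGraph_isLayeredEigenfunction {g : Bool × {s : Finset (Fin 8) // s.card = 2} → ℤ}
    {θ : ℤ} (hθ : θ ≠ 0)
    (hl : ∀ y, ∑ z, (if gossetGraph.Adj y z ∧ gossetLayer z + 1 = gossetLayer y then g z else 0)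
      = (if gossetLayer y = 2 then θ else 0) * g y)
    (hu : ∀ y, ∑ z, (if gossetGraph.Adj y z ∧ gossetLayer z = gossetLayer y + 1 then g z else 0)
      = (if gossetLayer y = 1 then θ else 0) * g y)
    (h0 : ∃ y, gossetLayer y = 1 ∧ g y ≠ 0) :
    IsLayeredEigenfunction gossetGraph gossetLayer 3 (fun y => g y)
      (fun i => if i = 2 then θ else 0) (fun i => if i = 1 then θ else 0) where
  sum_lower y := by
    have h := congrArg (Int.cast : ℤ → ℂ) (hl y)
    push_cast at h
    convert h
  sum_upper y := by
    have h := congrArg (Int.cast : ℤ → ℂ) (hu y)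
    push_cast at h
    convert h
  beta_one := by simp
  gamma_last := by simp
  gamma_ne_zero i hi hi' := by
    obtain rfl : i = 1 := by omega
    simpa using hθ
  exists_ne_zero i hi hi' := by
    obtain rfl : i = 1 := by omega
    obtain ⟨y, hy, hy'⟩ := h0
    exact ⟨y, hy, by exact_mod_cast hy'⟩

/-- Together with the exchange of the two copies, this gives vertex-transitivity of the Gosset graph
and reduces to `gossetBase`. -/
theorem exists_perm_map_eq {α : Type*} [Fintype α] [DecidableEq α] {s t : Finset α}
    (h : s.card = t.card) : ∃ σ : Equiv.Perm α, s.map σ.toEmbedding = t := by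
  let e : {a // a ∈ s} ≃ {a // a ∈ t} := s.equivOfCardEq h
  refine ⟨e.extendSubtype, Finset.eq_of_subset_of_card_le ?_ (by rw [Finset.card_map, h])⟩
  intro b hb
  obtain ⟨a, ha, rfl⟩ := Finset.mem_map.1 hb
  exact e.extendSubtype_mem a ha

/-- The automorphism of the Gosset graph induced by a permutation of the eight points, followed by
exchanging the two copies if `c` is true. -/
def gossetIso (c : Bool) (σ : Equiv.Perm (Fin 8)) : gossetGraph ≃g gossetGraph where
  toFun y := (xor y.1 c, ⟨y.2.1.map σ.toEmbedding, by rw [Finset.card_map, y.2.2]⟩)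
  invFun y := (xor y.1 c, ⟨y.2.1.map σ.symm.toEmbedding, by rw [Finset.card_map, y.2.2]⟩)
  left_inv y := by
    ext1
    · simp
    · ext a
      simp
  right_inv y := by
    ext1
    · simp
    · ext a
      simp
  map_rel_iff' {y z} := by
    simp [gossetGraph, ← Finset.map_inter]

theorem gossetGraph_not_supportsUniformStructure {X : Type*} [Fintype X] [DecidableEq X]
    {Γ : SimpleGraph X} (x : X) (e : Γ ≃g gossetGraph) : ¬ SupportsUniformStructure Γ x := by
  obtain ⟨σ, hσ⟩ := exists_perm_map_eq (s := (e x).2.1) (t := {0, 1}) (e x).2.2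
  have he : gossetIso (e x).1 σ (e x) = gossetBase :=
    Prod.ext (Bool.xor_self _) (Subtype.ext hσ)
  have hℓ : IsLayerFunction gossetGraph ((e.trans (gossetIso (e x).1 σ)) x) gossetLayer 3 := by
    change IsLayerFunction gossetGraph (gossetIso (e x).1 σ (e x)) gossetLayer 3
    rw [he]
    exact gossetGraph_isLayerFunction
  -- From `{0, j}` in layer 1, the upper neighbours with nonzero value are the five sets `{1, k}`,
  -- `k ≠ 0, 1, j`, of the other copy, each of opposite sign. For the product function below only
  -- one term survives at `{0, 2}`, namely `{1, 3}`, with equal sign. Thus `γ 1 * β 2` is 25 and 1.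
  have h1 := gossetGraph_isLayeredEigenfunction (g := gossetDiff 0 1) (θ := -5) (by decide)
    (by decide +kernel) (by decide +kernel) (by decide +kernel)
  have h2 := gossetGraph_isLayeredEigenfunction (g := fun y => gossetDiff 0 1 y * gossetDiff 2 3 y)
    (θ := 1) (by decide) (by decide +kernel) (by decide +kernel) (by decide +kernel)
  refine not_supportsUniformStructure_of_eigenfunctions le_rfl (hℓ.comp_iso _) (h1.comp_iso _)
    (h2.comp_iso _) ?_
  norm_num

end Gosset

theorem corollary9p3 {X : Type*} [Fintype X] [DecidableEq X] (Γ : SimpleGraph X) (x : X)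
    (hΓ : (∃ D : ℕ, 3 ≤ D ∧ Nonempty (Γ ≃g johnsonGraph (2 * D) D)) ∨
      Nonempty (Γ ≃g gossetGraph) ∨
      (∃ n : ℕ, Even n ∧ 6 ≤ n ∧ Nonempty (Γ ≃g halvedCube n))) :
    ¬ SupportsUniformStructure Γ x := by
  rcases hΓ with ⟨D, hD, ⟨e⟩⟩ | ⟨⟨e⟩⟩ | ⟨n, hn, hn6, ⟨e⟩⟩
  · exact johnsonGraph_not_supportsUniformStructure x hD e
  · exact gossetGraph_not_supportsUniformStructure x e
  · obtain ⟨D, rfl⟩ := even_iff_exists_two_mul.1 hn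
    exact halvedCube_not_supportsUniformStructure x (by omega) e
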